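/- Let $n\ge 2$ and let $H^n$ be hyperbolic $n$-space with geodesic distance $d$. In the hyperboloid model, $H^n=\{x_0+te : x_0\in e^\perp,\ t\ge 1,\ t^2-\langle x_0,x_0\rangle=1\}\subset\mathbb{R}^{n+1}$, where $e$ is a fixed unit vector, and $\cosh d(x,y)=\mathcal{B}(x,y)$ with $\mathcal{B}(x_0+te,y_0+se)=ts-\langle x_0,y_0\rangle$. A bounded set $K\subseteq H^n$ is called complete if $\operatorname{diam}(K\cup\{z\})>\operatorname{diam}K$ for every $z\in H^n\setminus K$, and a set is called convex if it contains the geodesic segment joining any two of its points. An ideal point is a line spanned by a vector $w\in\mathbb{R}^{n+1}$ with $\mathcal{B}(w,w)=0$ and $\mathcal{B}(w,e)>0$. The horospheres at this ideal point are the sets $\{z\in H^n:\mathcal{B}(z,w)=s\}$ with $s>0$, and horospheres at the same ideal point are called parallel. The horosphere $\{\mathcal{B}(\cdot,w)=s\}$ supports $K$ if it meets $K$ and either $\mathcal{B}(z,w)\le s$ for all $z\in K$ or $\mathcal{B}(z,w)\ge s$ for all $z\in K$. The distance of two horospheres is the infimum of $d(x,y)$ over points $x$ of the first and $y$ of the second.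 Theorem. Let $D>0$ and let $K\subseteq H^n$ be a bounded set with $\operatorname{diam}K=D$. Then $K$ is complete if and only if $K$ is compact and convex and the distance between any two distinct parallel supporting horospheres of $K$ is $D$. -/

import Mathlib

namespace HypGeom

/-- The space `ℝ^{n+1} = e^⊥ ⊕ ℝ e`: a pair `(x₀, t)` stands for `x₀ + t e`. -/
abbrev Ambient (n : ℕ) : Type := EuclideanSpace ℝ (Fin n) × ℝ

/-- The Lorentzian form `𝓑(x₀ + t e, y₀ + s e) = t s - ⟨x₀, y₀⟩`. -/
noncomputable def lorentz {n : ℕ} (x y : Ambient n) : ℝ := x.2 * y.2 - inner ℝ x.1 y.1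

/-- Hyperbolic `n`-space, as the upper sheet of the hyperboloid `𝓑(x, x) = 1`. -/
@[ext]
structure HypSpace (n : ℕ) where
  /-- the underlying vector of `ℝ^{n+1}` -/
  val : Ambient n
  one_le : 1 ≤ val.2
  lorentz_self : lorentz val val = 1

section Metric

variable {n : ℕ}

theorem lorentz_comm (x y : Ambient n) : lorentz x y = lorentz y x := by
  simp only [lorentz, real_inner_comm, mul_comm]

theorem lorentz_add_left (x y z : Ambient n) :
    lorentz (x + y) z = lorentz x z + lorentz y z := by
  simp only [lorentz, Prod.fst_add, Prod.snd_add, inner_add_left]; ring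

theorem lorentz_smul_left (c : ℝ) (x z : Ambient n) :
    lorentz (c • x) z = c * lorentz x z := by
  simp only [lorentz, Prod.smul_fst, Prod.smul_snd, real_inner_smul_left, smul_eq_mul]; ring

theorem lorentz_add_right (x y z : Ambient n) :
    lorentz x (y + z) = lorentz x y + lorentz x z := by
  rw [lorentz_comm, lorentz_add_left, lorentz_comm y, lorentz_comm z]

theorem lorentz_smul_right (c : ℝ) (x z : Ambient n) :
    lorentz x (c • z) = c * lorentz x z := by
  rw [lorentz_comm, lorentz_smul_left, lorentz_comm]

theorem HypSpace.sq_snd (x : HypSpace n) : x.val.2 ^ 2 = 1 + ‖x.val.1‖ ^ 2 := by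
  have h := x.lorentz_self
  simp only [lorentz, real_inner_self_eq_norm_sq] at h
  linarith

theorem one_le_lorentz (x y : HypSpace n) : 1 ≤ lorentz x.val y.val := by
  have hx := x.sq_snd
  have hy := y.sq_snd
  have hx1 := x.one_le
  have hy1 := y.one_le
  have hi := real_inner_le_norm x.val.1 y.val.1
  have h : (1 + ‖x.val.1‖ * ‖y.val.1‖) ≤ x.val.2 * y.val.2 := by
    refine le_of_abs_le (sq_le_sq.1 ?_ |>.trans_eq (abs_of_nonneg (by positivity)))
    rw [mul_pow, hx, hy]
    nlinarith [sq_nonneg (‖x.val.1‖ - ‖y.val.1‖)]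
  simp only [lorentz]
  linarith

/-- On the tangent space at a point, `𝓑` is negative semidefinite (quantitative form). -/
theorem lorentz_tangent (y : HypSpace n) (u : Ambient n) (h : lorentz u y.val = 0) :
    u.2 ^ 2 ≤ - lorentz u u * y.val.2 ^ 2 := by
  have hy := y.sq_snd
  simp only [lorentz, real_inner_self_eq_norm_sq] at h ⊢
  have hi := abs_real_inner_le_norm u.1 y.val.1
  have h2 : (u.2 * y.val.2) ^ 2 ≤ (‖u.1‖ * ‖y.val.1‖) ^ 2 := by
    rw [sub_eq_zero.1 h]
    exact sq_le_sq.2 (hi.trans (le_abs_self _))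
  nlinarith

theorem lorentz_tangent_nonpos (y : HypSpace n) (u : Ambient n) (h : lorentz u y.val = 0) :
    lorentz u u ≤ 0 := by
  have h1 := lorentz_tangent y u h
  have h2 : 0 < y.val.2 ^ 2 := by have := y.one_le; positivity
  by_contra! h3
  nlinarith [sq_nonneg u.2, mul_pos h3 h2]

theorem lorentz_tangent_cauchy (y : HypSpace n) (u v : Ambient n)
    (hu : lorentz u y.val = 0) (hv : lorentz v y.val = 0) :
    lorentz u v ^ 2 ≤ lorentz u u * lorentz v v := by
  have key : ∀ s : ℝ, 0 ≤ (- lorentz u u) * (s * s) + (-2 * lorentz u v) * s + (- lorentz v v) := by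
    intro s
    have h := lorentz_tangent_nonpos y (v + s • u) (by
      rw [lorentz_add_left, lorentz_smul_left, hu, hv]; ring)
    rw [lorentz_add_left, lorentz_add_right, lorentz_add_right, lorentz_smul_left,
      lorentz_smul_left, lorentz_smul_right, lorentz_smul_right, lorentz_comm v u] at h
    linarith
  have h := discrim_le_zero key
  simp only [discrim] at h
  linarith

theorem eq_of_lorentz_eq_one (x y : HypSpace n) (h : lorentz x.val y.val = 1) : x = y := by
  have hu : lorentz (x.val + (-1 : ℝ) • y.val) y.val = 0 := by
    rw [lorentz_add_left, lorentz_smul_left, h, y.lorentz_self]; ring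
  have huu : lorentz (x.val + (-1 : ℝ) • y.val) (x.val + (-1 : ℝ) • y.val) = 0 := by
    rw [lorentz_add_right, lorentz_smul_right, hu, lorentz_add_left, lorentz_smul_left,
      lorentz_comm y.val, h, x.lorentz_self]; ring
  have h1 := lorentz_tangent y _ hu
  rw [huu] at h1
  have h2 : (x.val + (-1 : ℝ) • y.val).2 = 0 := by
    have : (x.val + (-1 : ℝ) • y.val).2 ^ 2 = 0 := le_antisymm (by linarith) (sq_nonneg _)
    exact pow_eq_zero_iff (two_ne_zero) |>.1 this
  have h3 : (x.val + (-1 : ℝ) • y.val).1 = 0 := by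
    have h4 := huu
    simp only [lorentz, real_inner_self_eq_norm_sq, h2] at h4
    have : ‖(x.val + (-1 : ℝ) • y.val).1‖ = 0 := by
      apply pow_eq_zero_iff (two_ne_zero) |>.1; linarith
    exact norm_eq_zero.1 this
  have h5 : x.val + (-1 : ℝ) • y.val = 0 := Prod.ext h3 h2
  apply HypSpace.ext
  rw [neg_one_smul, ← sub_eq_add_neg] at h5
  exact sub_eq_zero.1 h5

theorem arcosh_lorentz_triangle (x y z : HypSpace n) :
    Real.arcosh (lorentz x.val z.val) ≤
      Real.arcosh (lorentz x.val y.val) + Real.arcosh (lorentz y.val z.val) := by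
  have ha := one_le_lorentz x y
  have hb := one_le_lorentz y z
  have hc := one_le_lorentz x z
  obtain ⟨a, hae⟩ : ∃ a, a = lorentz x.val y.val := ⟨_, rfl⟩
  obtain ⟨b, hbe⟩ : ∃ b, b = lorentz y.val z.val := ⟨_, rfl⟩
  rw [← hae] at ha ⊢
  rw [← hbe] at hb ⊢
  have hu : lorentz (x.val + (-a) • y.val) y.val = 0 := by
    rw [lorentz_add_left, lorentz_smul_left, y.lorentz_self, ← hae]; ring
  have hv : lorentz (z.val + (-b) • y.val) y.val = 0 := by
    rw [lorentz_add_left, lorentz_smul_left, y.lorentz_self, lorentz_comm z.val, ← hbe]; ring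
  have hcs := lorentz_tangent_cauchy y _ _ hu hv
  have e1 : lorentz (x.val + (-a) • y.val) (z.val + (-b) • y.val)
      = lorentz x.val z.val - a * b := by
    rw [lorentz_add_right, lorentz_smul_right, hu, lorentz_add_left, lorentz_smul_left, ← hbe]
    ring
  have e2 : lorentz (x.val + (-a) • y.val) (x.val + (-a) • y.val) = -(a ^ 2 - 1) := by
    rw [lorentz_add_right, lorentz_smul_right, hu, lorentz_add_left, lorentz_smul_left,
      lorentz_comm y.val, ← hae, x.lorentz_self]; ring
  have e3 : lorentz (z.val + (-b) • y.val) (z.val + (-b) • y.val) = -(b ^ 2 - 1) := by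
    rw [lorentz_add_right, lorentz_smul_right, hv, lorentz_add_left, lorentz_smul_left,
      ← hbe, z.lorentz_self]; ring
  rw [e1, e2, e3, neg_mul_neg] at hcs
  have hA := Real.arcosh_nonneg ha
  have hB := Real.arcosh_nonneg hb
  rw [← Real.arcosh_cosh (add_nonneg hA hB)]
  refine (Real.arcosh_le_arcosh (by linarith) (Real.cosh_pos _)).2 ?_
  rw [Real.cosh_add, Real.cosh_arcosh ha, Real.cosh_arcosh hb, Real.sinh_arcosh ha,
    Real.sinh_arcosh hb, ← Real.sqrt_mul (by nlinarith)]
  have := Real.abs_le_sqrt hcs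
  linarith [le_abs_self (lorentz x.val z.val - a * b)]

end Metric

/-- The geodesic distance `d(x, y) = arcosh 𝓑(x, y)`. -/
noncomputable instance (n : ℕ) : MetricSpace (HypSpace n) where
  dist x y := Real.arcosh (lorentz x.val y.val)
  dist_self x := by
    rw [x.lorentz_self]; exact (Real.arcosh_eq_zero_iff le_rfl).2 rfl
  dist_comm x y := by
    rw [lorentz_comm]
  dist_triangle := arcosh_lorentz_triangle
  eq_of_dist_eq_zero {x y} h :=
    eq_of_lorentz_eq_one x y ((Real.arcosh_eq_zero_iff (one_le_lorentz x y)).1 h)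

/-- `u` is a unit tangent vector at `x`; the tangent space `𝓑(·, x) = 0` carries the scalar
product `-𝓑`. -/
def IsUnitTangent {n : ℕ} (x : HypSpace n) (u : Ambient n) : Prop :=
  lorentz u x.val = 0 ∧ lorentz u u = -1

/-- The geodesic segment `[x, y]`: with `s ↦ cosh s • x + sinh s • u` the unit speed geodesic
line that starts at `x` and reaches `y` at time `t ≥ 0`, the points at the times in `[0, t]`. -/
def segment {n : ℕ} (x y : HypSpace n) : Set (HypSpace n) :=
  {p | ∃ (u : Ambient n) (t s : ℝ), IsUnitTangent x u ∧ 0 ≤ s ∧ s ≤ t ∧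
    y.val = Real.cosh t • x.val + Real.sinh t • u ∧
    p.val = Real.cosh s • x.val + Real.sinh s • u}

/-- Geodesic convexity. -/
def IsGeodConvex {n : ℕ} (K : Set (HypSpace n)) : Prop :=
  ∀ x ∈ K, ∀ y ∈ K, segment x y ⊆ K

/-- A bounded set is (diametrically) complete if adding any further point increases its
diameter. -/
def IsDiamComplete {n : ℕ} (K : Set (HypSpace n)) : Prop :=
  Bornology.IsBounded K ∧ ∀ z, z ∉ K → Metric.diam K < Metric.diam (insert z K)

/-- `w` spans a line that is an ideal point: `𝓑(w, w) = 0` and `𝓑(w, e) > 0`. -/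
def IsIdealVector {n : ℕ} (w : Ambient n) : Prop :=
  lorentz w w = 0 ∧ 0 < lorentz w (0, 1)

/-- For `s > 0`, a horosphere at the ideal point spanned by `w`. As `s` runs through `(0, ∞)`
these are all the horospheres at that ideal point, that is, a class of parallel horospheres.
(Replacing `w` by `c • w` replaces `s` by `c * s`.) -/
def horosphere {n : ℕ} (w : Ambient n) (s : ℝ) : Set (HypSpace n) :=
  {z | lorentz z.val w = s}

/-- For `s > 0`, the horosphere `horosphere w s` supports `K`: it meets `K`, and `K` lies on one
side of it, either inside the horoball `𝓑(·, w) ≤ s` or outside its interior. -/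
def IsSupportingHorosphere {n : ℕ} (K : Set (HypSpace n)) (w : Ambient n) (s : ℝ) : Prop :=
  (K ∩ horosphere w s).Nonempty ∧
    ((∀ z ∈ K, lorentz z.val w ≤ s) ∨ (∀ z ∈ K, s ≤ lorentz z.val w))

/-- The distance of two sets, `inf {d(x, y) : x ∈ S, y ∈ T}`. -/
noncomputable def setDist {n : ℕ} (S T : Set (HypSpace n)) : ℝ :=
  sInf {d | ∃ x ∈ S, ∃ y ∈ T, d = dist x y}

/-- Any two distinct parallel (same ideal point) supporting horospheres of `K` have
distance `D`. -/
def HasConstHorosphericalWidth {n : ℕ} (K : Set (HypSpace n)) (D : ℝ) : Prop :=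
  ∀ w : Ambient n, IsIdealVector w → ∀ r s : ℝ, 0 < r → 0 < s → r ≠ s →
    IsSupportingHorosphere K w r → IsSupportingHorosphere K w s →
      setDist (horosphere w r) (horosphere w s) = D

end HypGeom

namespace HypGeom

open Filter Topology

variable {n : ℕ}

/-! For an ideal vector `w`, `log 𝓑(·, w)` is a Busemann function: it is 1-Lipschitz and has slope
`-1` along geodesics running to `w`. So the horospheres at levels `r` and `s` lie `|log r - log s|`
apart, and the width condition says that this function oscillates by `D` on `K`.

A complete set contains every point within `diam K` of all its points, so it is an intersection of
balls; this makes it compact and convex. For the width, let `x ∈ K` maximize `𝓑(·, w)` and go from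
`x` a length `D` towards `w`. If the end point were outside `K`, some `k ∈ K` would be farther than
`D` from it, and `k` would yield a direction at `x` that leads into `K` while increasing `𝓑(·, w)`
(`IsDiamComplete.exists_mem_lorentz_eq`).

Conversely, given `z ∉ K` with nearest point `x ∈ K`, take the ideal point in direction `x → z`. By
convexity the horosphere through `x` supports `K`. The opposite supporting horosphere is at distance
`D` from it, hence at distance `D + d(x, z)` from `z`, so adding `z` enlarges the diameter. -/

theorem lorentz_sub_left (x y z : Ambient n) :
    lorentz (x - y) z = lorentz x z - lorentz y z := by
  rw [sub_eq_add_neg, ← neg_one_smul ℝ y, lorentz_add_left, lorentz_smul_left]; ring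

theorem lorentz_sub_right (x y z : Ambient n) :
    lorentz x (y - z) = lorentz x y - lorentz x z := by
  rw [lorentz_comm, lorentz_sub_left, lorentz_comm y, lorentz_comm z]

theorem cosh_dist (x y : HypSpace n) : Real.cosh (dist x y) = lorentz x.val y.val :=
  Real.cosh_arcosh (one_le_lorentz x y)

theorem dist_le_iff_lorentz_le_cosh {x y : HypSpace n} {r : ℝ} (hr : 0 ≤ r) :
    dist x y ≤ r ↔ lorentz x.val y.val ≤ Real.cosh r := by
  rw [← cosh_dist, Real.cosh_le_cosh, abs_of_nonneg dist_nonneg, abs_of_nonneg hr]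

theorem lorentz_unitTangent_mem_Icc {x : HypSpace n} {u v : Ambient n}
    (hu : IsUnitTangent x u) (hv : IsUnitTangent x v) :
    lorentz u v ∈ Set.Icc (-1 : ℝ) 1 := by
  have h := lorentz_tangent_cauchy x u v hu.1 hv.1
  rw [hu.2, hv.2] at h
  exact abs_le.1 (abs_le_one_iff_mul_self_le_one.2 (by linarith))

/-- A tangent vector that is not orthogonal to every tangent vector has `𝓑(v, v) < 0`. -/
theorem lorentz_self_neg_of_lorentz_ne_zero {x : HypSpace n} {u v : Ambient n}
    (hu : lorentz u x.val = 0) (hv : lorentz v x.val = 0) (h : lorentz v u ≠ 0) :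
    lorentz v v < 0 := by
  refine (lorentz_tangent_nonpos x v hv).lt_of_ne fun h0 => ?_
  have := lorentz_tangent_cauchy x v u hv hu
  rw [h0, zero_mul] at this
  exact h (pow_eq_zero_iff two_ne_zero |>.1 (le_antisymm this (sq_nonneg _)))

/-- The point reached at time `t` by the geodesic that starts at `x` in direction `u`. -/
noncomputable def geodesic (x : HypSpace n) (u : Ambient n) (hu : IsUnitTangent x u) (t : ℝ) :
    HypSpace n where
  val := Real.cosh t • x.val + Real.sinh t • u
  lorentz_self := by
    simp only [lorentz_add_left, lorentz_add_right, lorentz_smul_left, lorentz_smul_right,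
      x.lorentz_self, hu.1, hu.2, lorentz_comm x.val u]
    linarith [Real.cosh_sq t]
  one_le := by
    have h1 : lorentz (Real.cosh t • x.val + Real.sinh t • u)
        (Real.cosh t • x.val + Real.sinh t • u) = 1 := by
      simp only [lorentz_add_left, lorentz_add_right, lorentz_smul_left, lorentz_smul_right,
        x.lorentz_self, hu.1, hu.2, lorentz_comm x.val u]
      linarith [Real.cosh_sq t]
    have h2 : (Real.cosh t • x.val + Real.sinh t • u).2
        = Real.cosh t * x.val.2 + Real.sinh t * u.2 := by simp
    have hx := x.one_le
    have h3 := lorentz_tangent x u hu.1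
    rw [hu.2, neg_neg, one_mul] at h3
    -- This bound keeps the whole geodesic on the upper sheet.
    have h4 : |u.2| ≤ x.val.2 := abs_le_of_sq_le_sq h3 (by linarith)
    have h5 : |Real.sinh t| ≤ Real.cosh t :=
      abs_le_of_sq_le_sq (by linarith [Real.cosh_sq t]) (Real.cosh_pos t).le
    have h6 : |Real.sinh t * u.2| ≤ Real.cosh t * x.val.2 := by
      rw [abs_mul]; exact mul_le_mul h5 h4 (abs_nonneg _) (Real.cosh_pos t).le
    have h7 : 0 ≤ (Real.cosh t • x.val + Real.sinh t • u).2 := by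
      rw [h2]; linarith [neg_abs_le (Real.sinh t * u.2)]
    simp only [lorentz, real_inner_self_eq_norm_sq] at h1
    nlinarith [sq_nonneg ‖(Real.cosh t • x.val + Real.sinh t • u).1‖]

theorem lorentz_geodesic (x : HypSpace n) {u : Ambient n} (hu : IsUnitTangent x u) (t : ℝ)
    (z : Ambient n) : lorentz (geodesic x u hu t).val z
      = Real.cosh t * lorentz x.val z + Real.sinh t * lorentz u z := by
  simp only [geodesic, lorentz_add_left, lorentz_smul_left]

theorem dist_geodesic (x : HypSpace n) {u : Ambient n} (hu : IsUnitTangent x u) (t : ℝ) :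
    dist x (geodesic x u hu t) = |t| := by
  change Real.arcosh _ = _
  rw [lorentz_comm, lorentz_geodesic, x.lorentz_self, hu.1, mul_one, mul_zero, add_zero,
    ← Real.cosh_abs, Real.arcosh_cosh (abs_nonneg t)]

theorem exists_eq_geodesic {x y : HypSpace n} (h : x ≠ y) :
    ∃ (u : Ambient n) (hu : IsUnitTangent x u), y = geodesic x u hu (dist x y) := by
  have hd : 0 < dist x y := dist_pos.2 h
  have hs : 0 < Real.sinh (dist x y) := Real.sinh_pos_iff.2 hd
  have hc := cosh_dist x y
  have hsq := Real.cosh_sq (dist x y)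
  set t := dist x y
  have hu : IsUnitTangent x ((Real.sinh t)⁻¹ • (y.val - Real.cosh t • x.val)) := by
    constructor
    · rw [lorentz_smul_left, lorentz_sub_left, lorentz_smul_left, x.lorentz_self,
        lorentz_comm y.val, hc]
      ring
    · simp only [lorentz_smul_left, lorentz_smul_right, lorentz_sub_left, lorentz_sub_right,
        x.lorentz_self, y.lorentz_self, lorentz_comm y.val x.val, ← hc]
      field_simp
      linarith
  refine ⟨_, hu, HypSpace.ext ?_⟩
  simp only [geodesic]
  rw [smul_inv_smul₀ hs.ne', add_sub_cancel]

/-! ### Ideal points, Busemann functions and horospheres -/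

theorem IsIdealVector.lorentz_pos {w : Ambient n} (hw : IsIdealVector w) (x : HypSpace n) :
    0 < lorentz x.val w := by
  obtain ⟨h0, h1⟩ := hw
  have hx := x.sq_snd
  have hx1 := x.one_le
  simp only [lorentz, real_inner_self_eq_norm_sq, inner_zero_right, mul_one, sub_zero] at h0 h1 ⊢
  have hn : ‖w.1‖ = w.2 :=
    (sq_eq_sq₀ (norm_nonneg _) h1.le).1 (by linarith)
  have hi := real_inner_le_norm x.val.1 w.1
  have hlt : ‖x.val.1‖ < x.val.2 := lt_of_pow_lt_pow_left₀ 2 (by linarith) (by linarith)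
  rw [hn] at hi
  nlinarith

/-- The unit tangent vector at `x` pointing to the ideal point spanned by `w`. -/
theorem IsIdealVector.exists_eq_smul {w : Ambient n} (hw : IsIdealVector w) (x : HypSpace n) :
    ∃ u, IsUnitTangent x u ∧ w = lorentz x.val w • (x.val + u) := by
  have hp := hw.lorentz_pos x
  set r := lorentz x.val w with hr
  refine ⟨r⁻¹ • w - x.val, ⟨?_, ?_⟩, ?_⟩
  · rw [lorentz_sub_left, lorentz_smul_left, x.lorentz_self, lorentz_comm w, ← hr]
    field_simp; ring
  · simp only [lorentz_smul_left, lorentz_smul_right, lorentz_sub_left, lorentz_sub_right,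
        x.lorentz_self, lorentz_comm w x.val, ← hr, hw.1]
    field_simp; ring
  · rw [add_sub_cancel, smul_inv_smul₀ hp.ne']

theorem isIdealVector_add {x : HypSpace n} {u : Ambient n} (hu : IsUnitTangent x u) :
    IsIdealVector (x.val + u) := by
  have h0 : lorentz (x.val + u) (x.val + u) = 0 := by
    simp only [lorentz_add_left, lorentz_add_right, x.lorentz_self, hu.1, hu.2,
      lorentz_comm x.val u]
    ring
  refine ⟨h0, ?_⟩
  have h1 : lorentz x.val (x.val + u) = 1 := by
    rw [lorentz_add_right, x.lorentz_self, lorentz_comm, hu.1, add_zero]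
  have h3 := lorentz_tangent x u hu.1
  rw [hu.2, neg_neg, one_mul] at h3
  have h4 := neg_le_of_abs_le (abs_le_of_sq_le_sq h3 (by linarith [x.one_le]))
  have h5 : 0 ≤ (x.val + u).2 := by rw [Prod.snd_add]; linarith
  simp only [lorentz, real_inner_self_eq_norm_sq, inner_zero_right, mul_one, sub_zero] at h0 h1 ⊢
  refine h5.lt_of_ne fun h => ?_
  rw [← h] at h0 h1
  have h6 : (x.val + u).1 = 0 := by
    refine norm_eq_zero.1 (pow_eq_zero_iff two_ne_zero |>.1 ?_)
    linarith
  rw [h6, inner_zero_right] at h1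
  norm_num at h1

/-- A geodesic that leaves `x` for the ideal point `w` crosses the horospheres at `w`. -/
theorem IsIdealVector.exists_lorentz_eq_exp {w : Ambient n} (hw : IsIdealVector w)
    (x : HypSpace n) (t : ℝ) :
    ∃ y : HypSpace n, dist x y = |t| ∧ lorentz y.val w = Real.exp (-t) * lorentz x.val w := by
  obtain ⟨u, hu, hwu⟩ := hw.exists_eq_smul x
  refine ⟨geodesic x u hu t, dist_geodesic x hu t, ?_⟩
  have h : lorentz u w = - lorentz x.val w := by
    conv_lhs => rw [hwu]
    rw [lorentz_smul_right, lorentz_add_right, hu.1, hu.2]; ring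
  rw [lorentz_geodesic, h, ← Real.cosh_sub_sinh]; ring

/-- With `v`, `u` the unit directions from `x` to `y` and to `w`, and `d = dist x y`, the left side
is `(cosh d + sinh d * 𝓑(v, u)) * 𝓑(x, w)`, where `𝓑(v, u) ≤ 1`. -/
theorem IsIdealVector.lorentz_le_exp_dist_mul {w : Ambient n} (hw : IsIdealVector w)
    (x y : HypSpace n) : lorentz y.val w ≤ Real.exp (dist x y) * lorentz x.val w := by
  by_cases hxy : x = y
  · simp [hxy]
  obtain ⟨v, hv, hy⟩ := exists_eq_geodesic hxy
  obtain ⟨u, hu, hwu⟩ := hw.exists_eq_smul x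
  have h : lorentz v w = lorentz x.val w * lorentz v u := by
    conv_lhs => rw [hwu]
    rw [lorentz_smul_right, lorentz_add_right, hv.1, zero_add]
  have hs : 0 < Real.sinh (dist x y) := Real.sinh_pos_iff.2 (dist_pos.2 hxy)
  conv_lhs => rw [hy]
  rw [lorentz_geodesic, h, ← Real.cosh_add_sinh]
  have h1 := (lorentz_unitTangent_mem_Icc hv hu).2
  have h2 := mul_pos hs (hw.lorentz_pos x)
  nlinarith

theorem IsIdealVector.dist_log_lorentz_le {w : Ambient n} (hw : IsIdealVector w)
    (x y : HypSpace n) :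
    |Real.log (lorentz x.val w) - Real.log (lorentz y.val w)| ≤ dist x y := by
  have key (a b : HypSpace n) :
      Real.log (lorentz b.val w) ≤ dist a b + Real.log (lorentz a.val w) := by
    rw [← Real.log_exp (dist a b), ← Real.log_mul (Real.exp_ne_zero _) (hw.lorentz_pos a).ne']
    exact Real.log_le_log (hw.lorentz_pos b) (hw.lorentz_le_exp_dist_mul a b)
  rw [abs_le]
  constructor
  · linarith [key x y]
  · linarith [key y x, dist_comm x y]

/-- The topology is that of the hyperbolic metric, not one induced from `Ambient n`, so continuity
comes from the Lipschitz bound. -/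
theorem IsIdealVector.continuous_lorentz {w : Ambient n} (hw : IsIdealVector w) :
    Continuous fun x : HypSpace n => lorentz x.val w := by
  have h : LipschitzWith 1 fun x : HypSpace n => Real.log (lorentz x.val w) :=
    LipschitzWith.of_dist_le_mul fun x y => by
      simpa [Real.dist_eq] using hw.dist_log_lorentz_le x y
  exact (Real.continuous_exp.comp h.continuous).congr fun x => Real.exp_log (hw.lorentz_pos x)

theorem continuous_lorentz_val (y : HypSpace n) :
    Continuous fun x : HypSpace n => lorentz x.val y.val := by
  simp_rw [← cosh_dist]
  fun_prop

theorem continuous_lorentz_unitTangent {x : HypSpace n} {u : Ambient n}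
    (hu : IsUnitTangent x u) : Continuous fun y : HypSpace n => lorentz y.val u := by
  refine ((isIdealVector_add hu).continuous_lorentz.sub (continuous_lorentz_val x)).congr
    fun y => ?_
  simp only [Pi.sub_apply, lorentz_add_right, add_sub_cancel_left]

/-- The Lipschitz bound gives `≥`; a geodesic running to or from the ideal point attains it. -/
theorem setDist_horosphere {w : Ambient n} (hw : IsIdealVector w) {r s : ℝ}
    (hs : 0 < s) (hne : (horosphere w r).Nonempty) :
    setDist (horosphere w r) (horosphere w s) = |Real.log r - Real.log s| := by
  obtain ⟨x, hx⟩ := hne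
  have hx' : lorentz x.val w = r := hx
  have hr : 0 < r := hx' ▸ hw.lorentz_pos x
  obtain ⟨y, hxy, hy⟩ := hw.exists_lorentz_eq_exp x (Real.log r - Real.log s)
  have hmem : |Real.log r - Real.log s| ∈
      {d | ∃ x ∈ horosphere w r, ∃ y ∈ horosphere w s, d = dist x y} := by
    refine ⟨x, hx, y, ?_, hxy.symm⟩
    change lorentz y.val w = s
    rw [hy, hx', neg_sub, Real.exp_sub, Real.exp_log hr, Real.exp_log hs]
    field_simp
  refine IsLeast.csInf_eq ⟨hmem, ?_⟩
  rintro d ⟨a, ha, b, hb, rfl⟩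
  have h := hw.dist_log_lorentz_le a b
  rwa [show lorentz a.val w = r from ha, show lorentz b.val w = s from hb] at h

/-! ### Compactness of closed balls -/

/-- The base point of the hyperboloid. -/
noncomputable def origin (n : ℕ) : HypSpace n where
  val := (0, 1)
  one_le := le_rfl
  lorentz_self := by simp [lorentz]

theorem isCompact_closedBall_origin (R : ℝ) :
    IsCompact (Metric.closedBall (origin n) R) := by
  rcases lt_or_ge R 0 with hR | hR
  · rw [Metric.closedBall_eq_empty.2 hR]; exact isCompact_empty
  let H : Set (Ambient n) := {v | 1 ≤ v.2 ∧ lorentz v v = 1}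
  let f : H → HypSpace n := fun v => ⟨v.1, v.2.1, v.2.2⟩
  have hl : Continuous fun p : Ambient n × Ambient n => lorentz p.1 p.2 := by
    unfold lorentz; fun_prop
  have hf : Continuous f := by
    refine continuous_iff_continuousAt.2 fun v => tendsto_iff_dist_tendsto_zero.2 ?_
    have h1 : Continuous fun u : H => Real.arcosh (lorentz u.1 v.1) := by
      refine Real.continuousOn_arcosh.comp_continuous ?_ fun u => one_le_lorentz (f u) (f v)
      exact hl.comp (continuous_subtype_val.prodMk continuous_const)
    have h2 := h1.tendsto v
    rwa [v.2.2, (Real.arcosh_eq_zero_iff le_rfl).2 rfl] at h2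
  have hH : IsClosed H := (isClosed_le continuous_const continuous_snd).inter
    (isClosed_eq (hl.comp (continuous_id.prodMk continuous_id)) continuous_const)
  have hc : IsCompact ((Subtype.val : H → Ambient n) ⁻¹'
      (Metric.closedBall 0 (Real.cosh R))) :=
    hH.isClosedEmbedding_subtypeVal.isCompact_preimage (isCompact_closedBall _ _)
  -- The ball is a closed subset of the continuous image of a compact piece of the hyperboloid.
  refine (hc.image hf).of_isClosed_subset Metric.isClosed_closedBall fun x hx => ?_
  refine ⟨⟨x.val, x.one_le, x.lorentz_self⟩, ?_, rfl⟩
  have hx2 : x.val.2 ≤ Real.cosh R := by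
    have := (dist_le_iff_lorentz_le_cosh hR).1 (Metric.mem_closedBall.1 hx)
    simpa [lorentz, origin] using this
  have hx1 : ‖x.val.1‖ ≤ x.val.2 :=
    le_of_sq_le_sq (by linarith [x.sq_snd]) (by linarith [x.one_le])
  rw [Set.mem_preimage, mem_closedBall_zero_iff, Prod.norm_def]
  refine max_le (hx1.trans hx2) ?_
  rwa [Real.norm_eq_abs, abs_of_nonneg (by linarith [x.one_le])]

instance : ProperSpace (HypSpace n) :=
  ⟨fun x r => (isCompact_closedBall_origin (r + dist x (origin n))).of_isClosed_subset
    Metric.isClosed_closedBall (Metric.closedBall_subset_closedBall' le_rfl)⟩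

/-! ### Complete sets are compact and convex -/

/-- Serves first-variation arguments: after division by `sinh t` the second-order term still tends
to `0`. -/
theorem cosh_sub_one_le_sinh_sq (t : ℝ) : Real.cosh t - 1 ≤ Real.sinh t ^ 2 := by
  nlinarith [Real.cosh_sq t, Real.one_le_cosh t]

theorem isUnitTangent_normalize {x : HypSpace n} {v : Ambient n} (hv : lorentz v x.val = 0)
    (h : lorentz v v < 0) : IsUnitTangent x ((√(-lorentz v v))⁻¹ • v) := by
  have hs := Real.sq_sqrt (show 0 ≤ -lorentz v v by linarith)
  have hp : 0 < √(-lorentz v v) := Real.sqrt_pos.2 (by linarith)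
  constructor
  · rw [lorentz_smul_left, hv, mul_zero]
  · rw [lorentz_smul_left, lorentz_smul_right]
    field_simp
    linarith

theorem IsDiamComplete.mem_of_forall_dist_le {K : Set (HypSpace n)} (hK : IsDiamComplete K)
    {z : HypSpace n} (hz : ∀ y ∈ K, dist z y ≤ Metric.diam K) : z ∈ K := by
  by_contra hzK
  refine (hK.2 z hzK).not_ge (Metric.diam_le_of_forall_dist_le Metric.diam_nonneg ?_)
  rintro a (rfl | ha) b (rfl | hb)
  · rw [dist_self]; exact Metric.diam_nonneg
  · exact hz b hb
  · rw [dist_comm]; exact hz a ha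
  · exact Metric.dist_le_diam_of_mem hK.1 ha hb

theorem IsDiamComplete.isCompact {K : Set (HypSpace n)} (hK : IsDiamComplete K) :
    IsCompact K := by
  refine Metric.isCompact_of_isClosed_isBounded (isClosed_of_closure_subset fun z hz => ?_) hK.1
  refine hK.mem_of_forall_dist_le fun y hy => ?_
  exact closure_minimal (t := Metric.closedBall y (Metric.diam K))
    (fun a ha => Metric.dist_le_diam_of_mem hK.1 ha hy) Metric.isClosed_closedBall hz

/-- Balls are convex: `sinh t • p = sinh (t - s) • x + sinh s • y`, and the coefficients on the
right sum to at most `sinh t`. -/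
theorem IsDiamComplete.isGeodConvex {K : Set (HypSpace n)} (hK : IsDiamComplete K) :
    IsGeodConvex K := by
  rintro x hx y hy p ⟨u, t, s, hu, hs, hst, hyt, hps⟩
  refine hK.mem_of_forall_dist_le fun q hq => ?_
  have hx1 := (dist_le_iff_lorentz_le_cosh Metric.diam_nonneg).1
    (Metric.dist_le_diam_of_mem hK.1 hx hq)
  have hy1 := (dist_le_iff_lorentz_le_cosh Metric.diam_nonneg).1
    (Metric.dist_le_diam_of_mem hK.1 hy hq)
  rw [dist_le_iff_lorentz_le_cosh Metric.diam_nonneg]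
  rcases (hs.trans hst).eq_or_lt with h0 | ht
  · obtain rfl : s = 0 := by linarith
    rw [hps]
    simpa using hx1
  have hS := Real.sinh_pos_iff.2 ht
  have h1 : Real.sinh t * lorentz p.val q.val
      = Real.sinh (t - s) * lorentz x.val q.val + Real.sinh s * lorentz y.val q.val := by
    rw [hps, hyt]
    simp only [lorentz_add_left, lorentz_smul_left, Real.sinh_sub]
    ring
  have h2 : Real.sinh (t - s) + Real.sinh s ≤ Real.sinh t := by
    have ha := Real.sinh_nonneg_iff.2 (sub_nonneg.2 hst)
    have hb := Real.sinh_nonneg_iff.2 hs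
    have h3 := Real.sinh_add (t - s) s
    rw [sub_add_cancel] at h3
    nlinarith [Real.one_le_cosh s, Real.one_le_cosh (t - s)]
  have ha := Real.sinh_nonneg_iff.2 (sub_nonneg.2 hst)
  have hb := Real.sinh_nonneg_iff.2 hs
  have hc := Real.cosh_pos (Metric.diam K)
  refine le_of_mul_le_mul_left ?_ hS
  rw [h1]
  calc _ ≤ Real.sinh (t - s) * Real.cosh (Metric.diam K)
        + Real.sinh s * Real.cosh (Metric.diam K) := by gcongr
    _ ≤ _ := by rw [← add_mul]; gcongr

/-! ### Complete sets have constant width -/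

/-- A direction that makes an acute angle with all diametral chords at `x` leads into `K`. -/
theorem IsDiamComplete.exists_geodesic_mem {K : Set (HypSpace n)} (hK : IsDiamComplete K)
    {x : HypSpace n} (hx : x ∈ K) {v : Ambient n} (hv : IsUnitTangent x v)
    (h : ∀ y ∈ K, dist x y = Metric.diam K → lorentz y.val v < 0) :
    ∃ t, 0 < t ∧ geodesic x v hv t ∈ K := by
  by_contra! hcon
  set C := Real.cosh (Metric.diam K)
  -- Each point at time `1 / (m + 1)` is too far from some `y m ∈ K`. A limit `a` of these ends a
  -- diametral chord at `x` with `𝓑(a, v) ≥ 0`.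
  have hsel (m : ℕ) : ∃ y ∈ K, C < Real.cosh (1 / ((m : ℝ) + 1)) * lorentz y.val x.val
      + Real.sinh (1 / ((m : ℝ) + 1)) * lorentz y.val v := by
    by_contra! hm
    refine hcon (1 / ((m : ℝ) + 1)) (by positivity) (hK.mem_of_forall_dist_le fun y hy => ?_)
    rw [dist_le_iff_lorentz_le_cosh Metric.diam_nonneg, lorentz_geodesic, lorentz_comm x.val,
      lorentz_comm v]
    exact hm y hy
  choose y hyK hy using hsel
  obtain ⟨a, haK, φ, hφ, hlim⟩ := hK.isCompact.tendsto_subseq hyK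
  have he : Tendsto (fun m => 1 / ((φ m : ℝ) + 1)) atTop (𝓝 0) :=
    (tendsto_one_div_add_atTop_nhds_zero_nat (𝕜 := ℝ)).comp hφ.tendsto_atTop
  have hc : Tendsto (fun m => Real.cosh (1 / ((φ m : ℝ) + 1))) atTop (𝓝 1) := by
    simpa [Function.comp_def] using (Real.continuous_cosh.tendsto 0).comp he
  have hs : Tendsto (fun m => Real.sinh (1 / ((φ m : ℝ) + 1))) atTop (𝓝 0) := by
    simpa [Function.comp_def] using (Real.continuous_sinh.tendsto 0).comp he
  have hBx := ((continuous_lorentz_val x).tendsto a).comp hlim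
  have hBv := ((continuous_lorentz_unitTangent hv).tendsto a).comp hlim
  have h1 : C ≤ 1 * lorentz a.val x.val + 0 * lorentz a.val v :=
    ge_of_tendsto ((hc.mul hBx).add (hs.mul hBv)) (Eventually.of_forall fun m => (hy (φ m)).le)
  have hd : dist x a = Metric.diam K := by
    refine le_antisymm (Metric.dist_le_diam_of_mem hK.1 hx haK) ?_
    rw [one_mul, zero_mul, add_zero, lorentz_comm, ← cosh_dist, Real.cosh_le_cosh,
      abs_of_nonneg dist_nonneg, abs_of_nonneg Metric.diam_nonneg] at h1
    exact h1
  have h2 (m : ℕ) : 0 ≤ lorentz (y (φ m)).val v + C * Real.sinh (1 / ((φ m : ℝ) + 1)) := by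
    have hp : 0 < Real.sinh (1 / ((φ m : ℝ) + 1)) := Real.sinh_pos_iff.2 (by positivity)
    have hm := hy (φ m)
    have hle : lorentz (y (φ m)).val x.val ≤ C :=
      (dist_le_iff_lorentz_le_cosh Metric.diam_nonneg).1
        (Metric.dist_le_diam_of_mem hK.1 (hyK _) hx)
    have h3 := mul_le_mul_of_nonneg_left hle (Real.cosh_pos (1 / ((φ m : ℝ) + 1))).le
    have h4 := mul_le_mul_of_nonneg_left (cosh_sub_one_le_sinh_sq (1 / ((φ m : ℝ) + 1)))
      (Real.cosh_pos (Metric.diam K)).le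
    refine le_of_mul_le_mul_left ?_ hp
    linarith
  have h5 : 0 ≤ lorentz a.val v + C * 0 :=
    ge_of_tendsto (hBv.add (hs.const_mul C)) (Eventually.of_forall h2)
  have := h a haK hd
  linarith

/-- The inner normal of length `diam K` at a point of a supporting horosphere around `K` ends
in `K`. -/
theorem IsDiamComplete.exists_mem_lorentz_eq {K : Set (HypSpace n)} (hK : IsDiamComplete K)
    (hD : 0 < Metric.diam K) {w : Ambient n} (hw : IsIdealVector w) {x : HypSpace n}
    (hx : x ∈ K) (hmax : ∀ y ∈ K, lorentz y.val w ≤ lorentz x.val w) :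
    ∃ z ∈ K, Real.exp (Metric.diam K) * lorentz z.val w = lorentz x.val w := by
  obtain ⟨u, hu, hwu⟩ := hw.exists_eq_smul x
  have hw_tangent {v : Ambient n} (hv : lorentz v x.val = 0) :
      lorentz v w = lorentz x.val w * lorentz v u := by
    conv_lhs => rw [hwu]
    rw [lorentz_smul_right, lorentz_add_right, hv, zero_add]
  have hM := hw.lorentz_pos x
  refine ⟨geodesic x u hu (Metric.diam K), ?_, ?_⟩
  swap
  · rw [lorentz_geodesic, hw_tangent hu.1, hu.2, mul_neg_one, mul_neg, ← sub_eq_add_neg,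
      ← sub_mul, Real.cosh_sub_sinh, ← mul_assoc, ← Real.exp_add, add_neg_cancel, Real.exp_zero,
      one_mul]
  set D := Metric.diam K
  refine hK.mem_of_forall_dist_le fun k hk => ?_
  by_contra! hgt
  have hS := Real.sinh_pos_iff.2 hD
  have hC := Real.cosh_pos D
  have hlt := not_le.1 (mt (dist_le_iff_lorentz_le_cosh hD.le).2 hgt.not_ge)
  rw [lorentz_geodesic, lorentz_comm u] at hlt
  have hb : 1 < lorentz x.val k.val := by
    refine (one_le_lorentz x k).lt_of_ne fun h => ?_
    obtain rfl := eq_of_lorentz_eq_one x k h.symm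
    rw [x.lorentz_self, lorentz_comm, hu.1] at hlt
    linarith
  set b := lorentz x.val k.val with hbdef
  have hc0 : 0 < Real.cosh D * (b - 1) / Real.sinh D := by
    have : 0 < b - 1 := by linarith
    positivity
  have hcq : -lorentz k.val u < Real.cosh D * (b - 1) / Real.sinh D := by
    rw [lt_div_iff₀ hS]; linarith
  -- The lower bound `-𝓑(k, u) < a` gives `𝓑(v, u) > 0` for the `v` below. The upper bound, with `a
  -- > 0` and `𝓑(y, u) ≥ -sinh D`, gives `𝓑(y, v) < 0` at the end `y` of any diametral chord. The
  -- interval is nonempty because `k` is farther than `D` from the end point.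
  obtain ⟨a, hamax, hac⟩ := exists_between (max_lt hc0 hcq)
  obtain ⟨ha0, haq⟩ := max_lt_iff.1 hamax
  rw [lt_div_iff₀ hS] at hac
  set v : Ambient n := k.val - b • x.val - a • u with hvdef
  have hvx : lorentz v x.val = 0 := by
    rw [hvdef, lorentz_sub_left, lorentz_sub_left, lorentz_smul_left, lorentz_smul_left, hu.1,
      x.lorentz_self, lorentz_comm k.val, ← hbdef]
    ring
  have hvu : 0 < lorentz v u := by
    rw [hvdef, lorentz_sub_left, lorentz_sub_left, lorentz_smul_left, lorentz_smul_left, hu.2,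
      lorentz_comm x.val, hu.1]
    linarith
  have hvv := lorentz_self_neg_of_lorentz_ne_zero hu.1 hvx hvu.ne'
  have hρ : 0 < (√(-lorentz v v))⁻¹ := inv_pos.2 (Real.sqrt_pos.2 (by linarith))
  obtain ⟨t, ht, htK⟩ := hK.exists_geodesic_mem hx (isUnitTangent_normalize hvx hvv) (by
    intro y hy hxy
    rw [lorentz_smul_right]
    refine mul_neg_of_pos_of_neg hρ ?_
    obtain ⟨m, hm, hym⟩ := exists_eq_geodesic (dist_pos.1 (hD.trans_eq hxy.symm))
    have hky := (dist_le_iff_lorentz_le_cosh hD.le).1 (Metric.dist_le_diam_of_mem hK.1 hk hy)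
    have hyu : -Real.sinh D ≤ lorentz y.val u := by
      rw [hym, lorentz_geodesic, hxy, lorentz_comm x.val, hu.1]
      have := (lorentz_unitTangent_mem_Icc hm hu).1
      nlinarith
    have hyx : lorentz y.val x.val = Real.cosh D := by rw [lorentz_comm, ← cosh_dist, hxy]
    rw [hvdef, lorentz_sub_right, lorentz_sub_right, lorentz_smul_right, lorentz_smul_right, hyx,
      lorentz_comm y.val k.val]
    nlinarith)
  -- Since `𝓑(v, w) > 0`, the point found in `K` lies beyond the maximal level.
  have hfar := hmax _ htK
  rw [lorentz_geodesic, lorentz_smul_left, hw_tangent hvx] at hfar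
  have h1 := mul_pos (Real.sinh_pos_iff.2 ht) (mul_pos hρ (mul_pos hM hvu))
  nlinarith [Real.one_le_cosh t]

theorem IsDiamComplete.hasConstHorosphericalWidth {K : Set (HypSpace n)} (hK : IsDiamComplete K)
    (hD : 0 < Metric.diam K) : HasConstHorosphericalWidth K (Metric.diam K) := by
  have key {w : Ambient n} (hw : IsIdealVector w) {x y : HypSpace n} (hx : x ∈ K) (hy : y ∈ K)
      (hmax : ∀ z ∈ K, lorentz z.val w ≤ lorentz x.val w)
      (hmin : ∀ z ∈ K, lorentz y.val w ≤ lorentz z.val w) :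
      |Real.log (lorentz x.val w) - Real.log (lorentz y.val w)| = Metric.diam K := by
    refine le_antisymm ((hw.dist_log_lorentz_le x y).trans
      (Metric.dist_le_diam_of_mem hK.1 hx hy)) ?_
    obtain ⟨z, hz, hzw⟩ := hK.exists_mem_lorentz_eq hD hw hx hmax
    rw [← hzw, Real.log_mul (Real.exp_ne_zero _) (hw.lorentz_pos z).ne', Real.log_exp]
    have := Real.log_le_log (hw.lorentz_pos y) (hmin z hz)
    exact le_trans (by linarith) (le_abs_self _)
  rintro w hw r s hr hs hrs ⟨⟨x, hx, hxr⟩, h1⟩ ⟨⟨y, hy, hys⟩, h2⟩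
  rw [setDist_horosphere hw hs ⟨x, hxr⟩]
  obtain rfl : lorentz x.val w = r := hxr
  obtain rfl : lorentz y.val w = s := hys
  -- Two parallel horospheres supporting `K` from the same side coincide.
  rcases h1 with h1 | h1 <;> rcases h2 with h2 | h2
  · exact absurd (le_antisymm (h2 x hx) (h1 y hy)) hrs
  · exact key hw hx hy h1 h2
  · rw [abs_sub_comm]; exact key hw hy hx h2 h1
  · exact absurd (le_antisymm (h1 y hy) (h2 x hx)) hrs

/-! ### Constant width implies completeness -/

/-- First variation at the foot point `x` of `z` on a convex set. -/
theorem IsGeodConvex.lorentz_tangent_nonneg {K : Set (HypSpace n)} (hK : IsGeodConvex K)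
    {x z : HypSpace n} (hx : x ∈ K) (hmin : ∀ k ∈ K, dist z x ≤ dist z k)
    {v : Ambient n} (hv : IsUnitTangent x v) {t : ℝ} (ht : 0 < t)
    (hk : geodesic x v hv t ∈ K) : 0 ≤ lorentz z.val v := by
  have h1 : ∀ᶠ s : ℝ in 𝓝[>] 0,
      0 ≤ lorentz z.val v + lorentz z.val x.val * Real.sinh s := by
    filter_upwards [Ioo_mem_nhdsGT ht] with s hs
    have hp := Real.sinh_pos_iff.2 hs.1
    have hmem : geodesic x v hv s ∈ K :=
      hK x hx _ hk ⟨v, t, s, hv, hs.1.le, hs.2.le, rfl, rfl⟩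
    have h2 : lorentz z.val x.val ≤ lorentz (geodesic x v hv s).val z.val := by
      rw [lorentz_comm _ z.val, ← cosh_dist, ← cosh_dist, Real.cosh_le_cosh,
        abs_of_nonneg dist_nonneg, abs_of_nonneg dist_nonneg]
      exact hmin _ hmem
    rw [lorentz_geodesic, lorentz_comm x.val, lorentz_comm v] at h2
    have h3 := mul_le_mul_of_nonneg_left (cosh_sub_one_le_sinh_sq s)
      (zero_le_one.trans (one_le_lorentz z x))
    refine le_of_mul_le_mul_left ?_ hp
    linarith
  have h2 : Tendsto (fun s : ℝ => lorentz z.val v + lorentz z.val x.val * Real.sinh s)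
      (𝓝[>] 0) (𝓝 (lorentz z.val v + lorentz z.val x.val * Real.sinh 0)) :=
    Tendsto.mono_left (Continuous.tendsto (by fun_prop) 0) nhdsWithin_le_nhds
  have h3 := ge_of_tendsto h2 h1
  simpa using h3

theorem HasConstHorosphericalWidth.isDiamComplete {K : Set (HypSpace n)} (hcomp : IsCompact K)
    (hconv : IsGeodConvex K) (hD : 0 < Metric.diam K)
    (hwidth : HasConstHorosphericalWidth K (Metric.diam K)) : IsDiamComplete K := by
  refine ⟨hcomp.isBounded, fun z hz => ?_⟩
  have hnt : K.Nontrivial := by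
    rw [← Set.not_subsingleton_iff]
    exact fun h => hD.ne' (Metric.diam_subsingleton h)
  obtain ⟨x, hx, hmin⟩ := hcomp.exists_isMinOn hnt.nonempty
    (f := fun y => dist z y) (by fun_prop)
  replace hmin : ∀ k ∈ K, dist z x ≤ dist z k := fun k hk => hmin hk
  have hxz : x ≠ z := fun h => hz (h ▸ hx)
  have hτ := dist_pos.2 hxz
  obtain ⟨u, hu, hzu⟩ := exists_eq_geodesic hxz
  have hw := isIdealVector_add hu
  have hxw : lorentz x.val (x.val + u) = 1 := by
    rw [lorentz_add_right, x.lorentz_self, lorentz_comm, hu.1, add_zero]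
  -- The angle at `x` between `z` and `k` is at least a right angle. Strictness makes the two
  -- supporting horospheres distinct, as the width condition requires.
  have hlow (k : HypSpace n) (hk : k ∈ K) (hxk : x ≠ k) : 1 < lorentz k.val (x.val + u) := by
    obtain ⟨v, hv, hkv⟩ := exists_eq_geodesic hxk
    have hdk := dist_pos.2 hxk
    have h1 := hconv.lorentz_tangent_nonneg hx hmin hv hdk (hkv ▸ hk)
    rw [hzu, lorentz_geodesic, lorentz_comm x.val, hv.1, mul_zero, zero_add] at h1
    have h2 := nonneg_of_mul_nonneg_right h1 (Real.sinh_pos_iff.2 hτ)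
    rw [hkv, lorentz_geodesic, hxw, lorentz_add_right, hv.1, lorentz_comm v u]
    have h3 := mul_nonneg (Real.sinh_pos_iff.2 hdk).le h2
    have h4 := Real.one_lt_cosh.2 hdk.ne'
    linarith
  obtain ⟨y, hy, hmax⟩ := hcomp.exists_isMaxOn hnt.nonempty hw.continuous_lorentz.continuousOn
  replace hmax : ∀ k ∈ K, lorentz k.val (x.val + u) ≤ lorentz y.val (x.val + u) :=
    fun k hk => hmax hk
  obtain ⟨k, hk, hkx⟩ := hnt.exists_ne x
  have hy1 : 1 < lorentz y.val (x.val + u) := (hlow k hk hkx.symm).trans_le (hmax k hk)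
  have hlog := hwidth _ hw 1 _ one_pos (one_pos.trans hy1) hy1.ne
    ⟨⟨x, hx, hxw⟩, Or.inr fun k hk => ?_⟩ ⟨⟨y, hy, rfl⟩, Or.inl hmax⟩
  swap
  · by_cases hxk : x = k
    · rw [← hxk, hxw]
    · exact (hlow k hk hxk).le
  rw [setDist_horosphere hw (one_pos.trans hy1) ⟨x, hxw⟩, Real.log_one, zero_sub, abs_neg,
    abs_of_pos (Real.log_pos hy1)] at hlog
  have hzw : Real.log (lorentz z.val (x.val + u)) = -dist x z := by
    conv_lhs => rw [hzu]
    rw [lorentz_geodesic, hxw, lorentz_add_right, hu.1, hu.2, mul_one, zero_add, mul_neg_one,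
      ← sub_eq_add_neg, Real.cosh_sub_sinh, Real.log_exp]
  have hyz := (le_abs_self _).trans (hw.dist_log_lorentz_le y z)
  have hdiam := Metric.dist_le_diam_of_mem (hcomp.isBounded.insert z)
    (Set.mem_insert_of_mem z hy) (Set.mem_insert z K)
  linarith

end HypGeom

theorem theorem1p1 (n : ℕ) (hn : 2 ≤ n) (D : ℝ) (hD : 0 < D)
    (K : Set (HypGeom.HypSpace n)) (hK : Metric.diam K = D) :
    HypGeom.IsDiamComplete K ↔
      IsCompact K ∧ HypGeom.IsGeodConvex K ∧ HypGeom.HasConstHorosphericalWidth K D := by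
  subst hK
  exact ⟨fun h => ⟨h.isCompact, h.isGeodConvex, h.hasConstHorosphericalWidth hD⟩,
    fun h => h.2.2.isDiamComplete h.1 h.2.1 hD⟩
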